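/- Let $\Lambda_1,\Lambda_2\subset\mathbb{C}$ be lattices and let $T_i=\mathbb{C}/\Lambda_i$ be the corresponding flat tori, with projections $\pi_i:\mathbb{C}\to T_i$ and with the flat distance $d_i(\pi_i(z),\pi_i(w))=\min_{l\in\Lambda_i}|z-w+l|$. Assume that $T_1$ and $T_2$ have area $1$. Let $K>0$, and let $(f_n)_{n\in I}$ be any family of $K$-quasiconformal homeomorphisms $f_n:T_1\to T_2$. Then the family is (uniformly) equicontinuous: for every $\varepsilon>0$ there is $\delta>0$ such that $d_1(x,y)<\delta$ implies $d_2(f_n(x),f_n(y))<\varepsilon$, for all $n\in I$ and all $x,y\in T_1$. More precisely, let $J$ be the injectivity radius of $T_1$. Then for all $n\in I$, all $r$ with $0<r<J$ and all $x,y\in T_1$ with $d_1(x,y)<r$, $$d_2(f_n(x),f_n(y))\le\sqrt{\frac{\pi K}{2\log (J/r)}}.$$ Here a homeomorphism $f:T_1\to T_2$ is called $K$-quasiconformal if every local expression $F$ of $f$ in the charts given by local inverses of $\pi_1$ and $\pi_2$ is $K$-quasiconformal. A homeomorphism $F$ from an open set $U\subset\mathbb{C}$ onto an open subset of $\mathbb{C}$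 is called $K$-quasiconformal if it is differentiable almost everywhere in $U$, its differential $DF$ is locally square-integrable in $U$ and is also the distributional derivative of $F$ in $U$, and $\|DF\|^2\le K\det DF$ almost everywhere in $U$. With $\mu=F_{\bar z}/F_z$, the last condition says that $F$ preserves orientation and that its dilatation $(1+|\mu|)/(1-|\mu|)$ is at most $K$ almost everywhere. -/

import Mathlib

open MeasureTheory
open scoped ContDiff

noncomputable section

/-- The flat torus `ℂ / Λ`. Its topology, metric and group structure are Mathlib's quotient
structures; the quotient metric is
`dist (π z) (π w) = inf {|z - w + l| : l ∈ Λ}`, i.e. the Riemannian distance of the flat metric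
for which the projection `π : ℂ → ℂ / Λ` is a local isometry. -/
abbrev FlatTorus (Λ : Submodule ℤ ℂ) : Type := ℂ ⧸ Λ

namespace FlatTorus

/-- The universal covering `π : ℂ → ℂ / Λ`. -/
def proj (Λ : Submodule ℤ ℂ) (z : ℂ) : FlatTorus Λ := Submodule.Quotient.mk z

/-- The area of the flat torus `ℂ / Λ`: the Lebesgue measure of a fundamental domain of `Λ`. -/
def area (Λ : Submodule ℤ ℂ) : ℝ := ZLattice.covolume Λ (volume : Measure ℂ)

/-- The Riemannian exponential map of the flat torus at `p`, where every tangent space is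
identified isometrically with `ℂ` through the covering. -/
def expMap (Λ : Submodule ℤ ℂ) (p : FlatTorus Λ) (v : ℂ) : FlatTorus Λ := p + proj Λ v

/-- The injectivity radius: the supremum of the radii `s` such that at every point `p` the
exponential map is injective on the open disk of radius `s` of the tangent space at `p`
(being a local isometry, it is then a diffeomorphism onto its image). -/
def injRadius (Λ : Submodule ℤ ℂ) : ℝ :=
  sSup {s : ℝ | ∀ p : FlatTorus Λ, Set.InjOn (expMap Λ p) (Metric.ball 0 s)}

end FlatTorus

/-- `F` is a `K`-quasiconformal homeomorphism of the open set `U ⊆ ℂ` onto an open subset of `ℂ`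
(analytic definition). With `λ₁ ≥ λ₂` the singular values of the real differential `DF`, one has
`‖DF‖ = λ₁ = |F_z| + |F_z̄|` and, for `det DF ≥ 0`,
`det DF = λ₁ λ₂ = (|F_z| + |F_z̄|) (|F_z| - |F_z̄|)`.
So `dilatation` says that, almost everywhere, `F` preserves orientation (`det DF ≥ 0`) and its
dilatation `λ₁ / λ₂ = (1 + |μ|) / (1 - |μ|)`, `μ = F_z̄ / F_z`, is at most `K`. -/
structure IsPlaneQuasiconformal (K : ℝ) (U : Set ℂ) (F : ℂ → ℂ) : Prop where
  /-- `F` is a homeomorphism from `U` onto an open set. -/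
  isOpenEmbedding : Topology.IsOpenEmbedding (U.domRestrict F)
  /-- `F` is differentiable almost everywhere in `U`. -/
  ae_differentiable : ∀ᵐ z ∂(volume.restrict U), DifferentiableAt ℝ F z
  /-- The differential is locally square-integrable in `U`. -/
  locallyIntegrable_sq : LocallyIntegrableOn (fun z => ‖fderiv ℝ F z‖ ^ 2) U volume
  /-- The differential is also the weak (distributional) derivative of `F` in `U`. -/
  weak_derivative : ∀ φ : ℂ → ℝ, ContDiff ℝ ∞ φ → HasCompactSupport φ → tsupport φ ⊆ U →
    ∀ v : ℂ, ∫ z, (fderiv ℝ φ z v) • F z = - ∫ z, φ z • fderiv ℝ F z v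
  /-- The dilatation is at most `K` almost everywhere in `U`. -/
  dilatation : ∀ᵐ z ∂(volume.restrict U), ‖fderiv ℝ F z‖ ^ 2 ≤ K * (fderiv ℝ F z).det

/-- A homeomorphism between flat tori is `K`-quasiconformal if all its expressions in the
conformal charts given by the local inverses of the coverings are: `F` is the expression of `f`
on `U` when the covering of the source is injective on `U` and `F` is a continuous lift of `f`
over `U` (the covering of the target is then injective on `F '' U`, because `f` is injective). -/
def IsTorusQuasiconformal (K : ℝ) {Λ₁ Λ₂ : Submodule ℤ ℂ} (f : FlatTorus Λ₁ ≃ₜ FlatTorus Λ₂) :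
    Prop :=
  ∀ (U : Set ℂ) (F : ℂ → ℂ), IsOpen U → Set.InjOn (FlatTorus.proj Λ₁) U → ContinuousOn F U →
    (∀ z ∈ U, FlatTorus.proj Λ₂ (F z) = f (FlatTorus.proj Λ₁ z)) → IsPlaneQuasiconformal K U F

end

/-! The proof is the length-area method. Lift `f` to `F : ℂ → ℂ` and let `c` lie over `y`. The disk
of radius `J` about `c` embeds in the first torus, and its image under `F` embeds in the second, so
that image has area at most 1. Bounded dilatation then gives `∫ ‖DF‖² ≤ K` over the disk.

For `r < ρ < J`, openness of `F` puts two points on the circle of radius `ρ` whose images are at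
least `D = ‖F x - F c‖` apart. The image of the circle is closed, so its length is at least `2D`.
Cauchy–Schwarz turns this into `4D²/ρ ≤ 2π ρ ∫ ‖DF‖² dθ`, and integrating over `ρ` gives `4D² log
(J/r) ≤ 2πK` (`length_area_inequality`).

Since `F` has only a weak derivative, circles are measured on mollifications, which do not increase
the energy (`lintegral_fderiv_convolution_sq_le`) and converge uniformly to `F` on smaller disks. -/

/-! ### Length-area inequality for smooth maps -/

/-- Cauchy–Schwarz inequality against the constant function `1`. -/
theorem MeasureTheory.sq_lintegral_le {α : Type*} [MeasurableSpace α] (μ : Measure α)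
    {f : α → ENNReal} (hf : AEMeasurable f μ) :
    (∫⁻ a, f a ∂μ) ^ 2 ≤ μ Set.univ * ∫⁻ a, f a ^ 2 ∂μ := by
  have h := ENNReal.lintegral_mul_le_Lp_mul_Lq μ (Real.HolderConjugate.two_two) hf
    (aemeasurable_const (b := (1 : ENNReal)))
  simp only [Pi.mul_apply, mul_one, ENNReal.one_rpow, lintegral_one] at h
  calc (∫⁻ a, f a ∂μ) ^ 2
      ≤ ((∫⁻ a, f a ^ (2 : ℝ) ∂μ) ^ (1 / 2 : ℝ) * μ Set.univ ^ (1 / 2 : ℝ)) ^ 2 := by gcongr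
    _ = μ Set.univ * ∫⁻ a, f a ^ 2 ∂μ := by
        rw [mul_pow, ← ENNReal.rpow_mul_natCast, ← ENNReal.rpow_mul_natCast, mul_comm]
        norm_num

/-- Two points of a circle are joined by two arcs, of total length that of the circle. -/
theorem two_mul_enorm_sub_le_lintegral_circle {h : ℂ → ℂ} (hh : ContDiff ℝ 1 h) (c : ℂ) {ρ : ℝ}
    (hρ : 0 ≤ ρ) {p q : ℂ} (hp : p ∈ Metric.sphere c ρ) (hq : q ∈ Metric.sphere c ρ) :
    2 * ‖h p - h q‖ₑ ≤
      ∫⁻ θ in Set.Ioo (-Real.pi) Real.pi, ‖fderiv ℝ h (circleMap c ρ θ)‖ₑ * ENNReal.ofReal ρ := by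
  set γ : ℝ → ℂ := fun θ => h (circleMap c ρ θ)
  set g : ℝ → ENNReal := fun θ => ‖fderiv ℝ h (circleMap c ρ θ)‖ₑ * ENNReal.ofReal ρ
  have hder : ∀ θ, HasDerivAt γ (fderiv ℝ h (circleMap c ρ θ) (circleMap 0 ρ θ * Complex.I)) θ :=
    fun θ => ((hh.differentiable one_ne_zero _).hasFDerivAt).comp_hasDerivAt θ
      (hasDerivAt_circleMap c ρ θ)
  have hcont : Continuous fun θ =>
      fderiv ℝ h (circleMap c ρ θ) (circleMap 0 ρ θ * Complex.I) :=
    ((hh.continuous_fderiv one_ne_zero).comp (continuous_circleMap c ρ)).clm_apply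
      ((continuous_circleMap 0 ρ).mul continuous_const)
  have arc : ∀ a b : ℝ, a ≤ b → ‖γ b - γ a‖ₑ ≤ ∫⁻ θ in Set.Ioc a b, g θ := by
    intro a b hab
    rw [← intervalIntegral.integral_eq_sub_of_hasDerivAt (fun θ _ => hder θ)
      (hcont.intervalIntegrable a b), intervalIntegral.integral_of_le hab]
    refine (enorm_integral_le_lintegral_enorm _).trans (lintegral_mono fun θ => ?_)
    refine (ContinuousLinearMap.le_opENorm _ _).trans ?_
    refine mul_le_mul_right (le_of_eq ?_) _
    rw [← ofReal_norm]
    simp [abs_of_nonneg hρ]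
  have hper : γ (-Real.pi) = γ Real.pi := by
    have := periodic_circleMap c ρ (-Real.pi)
    simp only [γ]
    rw [← this]
    congr 2; ring
  have key : ∀ a b : ℝ, -Real.pi ≤ a → a ≤ b → b ≤ Real.pi →
      2 * ‖γ b - γ a‖ₑ ≤ ∫⁻ θ in Set.Ioo (-Real.pi) Real.pi, g θ := by
    intro a b ha hab hb
    -- The complementary arc passes through the angle `±π`, where `γ` closes up.
    have h2 : ‖γ b - γ a‖ₑ ≤
        (∫⁻ θ in Set.Ioc (-Real.pi) a, g θ) + ∫⁻ θ in Set.Ioc b Real.pi, g θ := by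
      have : γ b - γ a = -((γ a - γ (-Real.pi)) + (γ Real.pi - γ b)) := by rw [hper]; ring
      rw [this, enorm_neg]
      exact (enorm_add_le _ _).trans (add_le_add (arc _ _ ha) (arc _ _ hb))
    rw [two_mul, restrict_Ioo_eq_restrict_Ioc, ← Set.Ioc_union_Ioc_eq_Ioc ha (hab.trans hb),
      lintegral_union measurableSet_Ioc
        (Set.Ioc_disjoint_Ioc_of_le le_rfl), ← Set.Ioc_union_Ioc_eq_Ioc hab hb,
      lintegral_union measurableSet_Ioc (Set.Ioc_disjoint_Ioc_of_le le_rfl)]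
    calc _ ≤ _ := add_le_add (arc a b hab) h2
      _ = _ := by ring
  have param : ∀ p ∈ Metric.sphere c ρ, ∃ a, -Real.pi ≤ a ∧ a ≤ Real.pi ∧ circleMap c ρ a = p := by
    intro p hp
    refine ⟨(p - c).arg, (Complex.neg_pi_lt_arg _).le, Complex.arg_le_pi _, ?_⟩
    rw [mem_sphere_iff_norm] at hp
    rw [circleMap, ← hp, Complex.norm_mul_exp_arg_mul_I]
    ring
  obtain ⟨a, ha, ha', rfl⟩ := param p hp
  obtain ⟨b, hb, hb', rfl⟩ := param q hq
  rcases le_total a b with hab | hab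
  · rw [enorm_sub_rev]; exact key a b ha hab hb'
  · exact key b a hb hab ha'

/-- Integration over a concentric annulus in polar coordinates. -/
theorem lintegral_circleMap_le_lintegral_ball {f : ℂ → ENNReal} (hf : Measurable f) (c : ℂ)
    {r R : ℝ} (hr : 0 ≤ r) :
    ∫⁻ ρ in Set.Ioo r R, ENNReal.ofReal ρ *
        ∫⁻ θ in Set.Ioo (-Real.pi) Real.pi, f (circleMap c ρ θ) ≤
      ∫⁻ z in Metric.ball c R, f z := by
  set g : ℂ → ENNReal := (Metric.ball c R).indicator f with hg
  have hgm : Measurable g := hf.indicator measurableSet_ball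
  rw [← lintegral_indicator measurableSet_ball, ← hg, ← lintegral_add_left_eq_self g c,
    ← Complex.lintegral_comp_polarCoord_symm]
  have hsub : Set.Ioo r R ×ˢ Set.Ioo (-Real.pi) Real.pi ⊆ polarCoord.target :=
    Set.prod_mono (fun x hx => hr.trans_lt hx.1) subset_rfl
  refine le_trans (le_of_eq ?_) (lintegral_mono_set hsub)
  have hmem : ∀ ρ θ : ℝ, c + Complex.polarCoord.symm (ρ, θ) = circleMap c ρ θ := by
    intro ρ θ
    rw [Complex.polarCoord_symm_apply, circleMap, Complex.exp_mul_I]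
    simp
  rw [Measure.volume_eq_prod, ← Measure.prod_restrict, lintegral_prod]
  · refine setLIntegral_congr_fun measurableSet_Ioo fun ρ hρ => ?_
    simp only [smul_eq_mul, hmem]
    rw [lintegral_const_mul' _ _ ENNReal.ofReal_ne_top]
    congr 1
    refine lintegral_congr fun θ => ?_
    rw [hg, Set.indicator_of_mem]
    rw [mem_ball_iff_norm]
    simp only [circleMap_sub_center, norm_circleMap_zero, abs_of_pos (hr.trans_lt hρ.1)]
    exact hρ.2
  · refine Measurable.aemeasurable ?_
    simp only [smul_eq_mul]
    refine (ENNReal.measurable_ofReal.comp measurable_fst).mul (hgm.comp ?_)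
    simp only [Complex.polarCoord_symm_apply]
    fun_prop

theorem lintegral_const_mul_inv {a r R : ℝ} (ha : 0 ≤ a) (hr : 0 < r) (hrR : r ≤ R) :
    ∫⁻ ρ in Set.Ioo r R, ENNReal.ofReal (a * ρ⁻¹) = ENNReal.ofReal (a * Real.log (R / r)) := by
  have hint : IntervalIntegrable (fun ρ : ℝ => a * ρ⁻¹) volume r R := by
    refine ContinuousOn.intervalIntegrable (continuousOn_const.mul
      (continuousOn_inv₀.mono fun x hx => ?_))
    rw [Set.uIcc_of_le hrR] at hx
    exact (hr.trans_le hx.1).ne'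
  rw [restrict_Ioo_eq_restrict_Ioc, ← ofReal_integral_eq_lintegral_ofReal
    ((intervalIntegrable_iff_integrableOn_Ioc_of_le hrR).1 hint),
    ← intervalIntegral.integral_of_le hrR, intervalIntegral.integral_const_mul,
    integral_inv_of_pos hr (hr.trans_le hrR)]
  refine (ae_restrict_iff' measurableSet_Ioc).2 (Filter.Eventually.of_forall fun ρ hρ => ?_)
  have : 0 < ρ := hr.trans hρ.1
  exact mul_nonneg ha (inv_nonneg.2 this.le)

/-- Cauchy–Schwarz on one circle. Dividing by `ρ` leaves the weight `ρ dθ` of polar coordinates,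
ready to be integrated over `ρ`. -/
theorem ofReal_four_mul_sq_mul_inv_le {h : ℂ → ℂ} (hh : ContDiff ℝ 1 h) (c : ℂ) {ρ D : ℝ}
    (hρ : 0 < ρ) {p q : ℂ} (hp : p ∈ Metric.sphere c ρ) (hq : q ∈ Metric.sphere c ρ)
    (hD : 0 ≤ D) (hpq : D ≤ ‖h p - h q‖) :
    ENNReal.ofReal (4 * D ^ 2 * ρ⁻¹) ≤ ENNReal.ofReal (2 * Real.pi) * (ENNReal.ofReal ρ *
      ∫⁻ θ in Set.Ioo (-Real.pi) Real.pi, ‖fderiv ℝ h (circleMap c ρ θ)‖ₑ ^ 2) := by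
  set G : ENNReal :=
    ∫⁻ θ in Set.Ioo (-Real.pi) Real.pi, ‖fderiv ℝ h (circleMap c ρ θ)‖ₑ ^ 2 with hG
  have h1 := two_mul_enorm_sub_le_lintegral_circle hh c hρ.le hp hq
  have hcρ : Continuous fun θ : ℝ => ‖fderiv ℝ h (circleMap c ρ θ)‖ₑ :=
    ((hh.continuous_fderiv one_ne_zero).comp (continuous_circleMap c ρ)).enorm
  rw [lintegral_mul_const _ hcρ.measurable] at h1
  have h2 := sq_lintegral_le (volume.restrict (Set.Ioo (-Real.pi) Real.pi))
    hcρ.measurable.aemeasurable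
  rw [← hG, Measure.restrict_apply_univ, Real.volume_Ioo,
    show Real.pi - -Real.pi = 2 * Real.pi by ring] at h2
  have h3 : ENNReal.ofReal (2 * D) ≤ 2 * ‖h p - h q‖ₑ := by
    rw [ENNReal.ofReal_mul zero_le_two, ← ofReal_norm, ENNReal.ofReal_ofNat]
    exact mul_le_mul_right (ENNReal.ofReal_le_ofReal hpq) 2
  have h4 : ENNReal.ofReal (2 * D) ^ 2 ≤
      ENNReal.ofReal (2 * Real.pi) * G * ENNReal.ofReal ρ ^ 2 := by
    refine (pow_le_pow_left' (h3.trans h1) 2).trans ?_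
    rw [mul_pow]
    exact mul_le_mul_left h2 _
  have h5 : ENNReal.ofReal ρ * ENNReal.ofReal ρ⁻¹ = 1 := by
    rw [← ENNReal.ofReal_mul hρ.le, mul_inv_cancel₀ hρ.ne', ENNReal.ofReal_one]
  have h6 : ENNReal.ofReal (4 * D ^ 2 * ρ⁻¹) =
      ENNReal.ofReal (2 * D) ^ 2 * ENNReal.ofReal ρ⁻¹ := by
    rw [← ENNReal.ofReal_pow (by positivity), ← ENNReal.ofReal_mul (by positivity)]
    congr 1; ring
  rw [h6]
  refine (mul_le_mul_left h4 _).trans (le_of_eq ?_)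
  rw [show ∀ a b x y : ENNReal, a * b * x ^ 2 * y = a * (x * b) * (x * y) by intros; ring, h5,
    mul_one]

/-- The length-area inequality for a `C¹` map. -/
theorem length_area_inequality {h : ℂ → ℂ} (hh : ContDiff ℝ 1 h) (c : ℂ) {r R D : ℝ}
    (hr : 0 < r) (hrR : r ≤ R) (hD : 0 ≤ D)
    (H : ∀ ρ ∈ Set.Ioo r R, ∃ p ∈ Metric.sphere c ρ, ∃ q ∈ Metric.sphere c ρ,
      D ≤ ‖h p - h q‖) :
    ENNReal.ofReal (4 * D ^ 2 * Real.log (R / r)) ≤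
      ENNReal.ofReal (2 * Real.pi) * ∫⁻ z in Metric.ball c R, ‖fderiv ℝ h z‖ₑ ^ 2 := by
  rw [← lintegral_const_mul_inv (by positivity) hr hrR]
  calc ∫⁻ ρ in Set.Ioo r R, ENNReal.ofReal (4 * D ^ 2 * ρ⁻¹)
      ≤ ∫⁻ ρ in Set.Ioo r R, ENNReal.ofReal (2 * Real.pi) * (ENNReal.ofReal ρ *
          ∫⁻ θ in Set.Ioo (-Real.pi) Real.pi, ‖fderiv ℝ h (circleMap c ρ θ)‖ₑ ^ 2) := by
        refine setLIntegral_mono' measurableSet_Ioo fun ρ hρ => ?_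
        obtain ⟨p, hp, q, hq, hpq⟩ := H ρ hρ
        exact ofReal_four_mul_sq_mul_inv_le hh c (hr.trans hρ.1) hp hq hD hpq
    _ ≤ _ := by
        rw [lintegral_const_mul' _ _ ENNReal.ofReal_ne_top]
        exact mul_le_mul_right (lintegral_circleMap_le_lintegral_ball
          ((hh.continuous_fderiv one_ne_zero).enorm.measurable.pow_const 2) c hr.le) _

/-- A continuous map that is open on a disk attains its largest distance from a given point on the
boundary circle. -/
theorem exists_sphere_norm_sub_le {F : ℂ → ℂ} (hF : Continuous F) {c : ℂ} {ρ : ℝ}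
    (hopen : IsOpen (F '' Metric.ball c ρ)) {z : ℂ} (hz : z ∈ Metric.closedBall c ρ) (w : ℂ) :
    ∃ p ∈ Metric.sphere c ρ, ‖F z - w‖ ≤ ‖F p - w‖ := by
  obtain ⟨p, hp, hmax⟩ := (isCompact_closedBall c ρ).exists_isMaxOn ⟨z, hz⟩
    (f := fun z => ‖F z - w‖) (by fun_prop)
  refine ⟨p, ?_, hmax hz⟩
  by_contra hps
  have hpb : p ∈ Metric.ball c ρ := lt_of_le_of_ne hp hps
  have hsub : F '' Metric.ball c ρ ⊆ Metric.closedBall w ‖F p - w‖ := by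
    rintro _ ⟨y, hy, rfl⟩
    rw [mem_closedBall_iff_norm]
    exact hmax (Metric.ball_subset_closedBall hy)
  -- An interior maximum point would have its image in the interior of a closed disk on whose
  -- boundary circle that image lies.
  have hmem := interior_maximal hsub hopen ⟨p, hpb, rfl⟩
  rw [interior_closedBall', mem_ball_iff_norm] at hmem
  exact lt_irrefl _ hmem

/-! ### Mollification of weak derivatives -/

/-- A derivative falling on the kernel of a convolution moves to the weakly differentiable
factor. -/
theorem fderiv_convolution_eq_of_weak_derivative {U : Set ℂ} {F : ℂ → ℂ} (hF : Continuous F)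
    (hw : ∀ φ : ℂ → ℝ, ContDiff ℝ ∞ φ → HasCompactSupport φ → tsupport φ ⊆ U →
      ∀ v : ℂ, ∫ z, (fderiv ℝ φ z v) • F z = - ∫ z, φ z • fderiv ℝ F z v)
    {η : ℂ → ℝ} (hη : ContDiff ℝ ∞ η) (hηc : HasCompactSupport η) {z : ℂ}
    (hz : ∀ w, z - w ∈ tsupport η → w ∈ U) (v : ℂ) :
    fderiv ℝ (convolution η F (ContinuousLinearMap.lsmul ℝ ℝ) volume) z v =
      ∫ w, η (z - w) • fderiv ℝ F w v := by
  have h1 : ContDiff ℝ 1 η := hη.of_le (by norm_cast)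
  have hφ : ContDiff ℝ ∞ fun w => η (z - w) := hη.comp (contDiff_const.sub contDiff_id)
  have hcl : IsClosed ((fun w => z - w) ⁻¹' tsupport η) :=
    (isClosed_tsupport η).preimage (by fun_prop)
  have hts : tsupport (fun w => η (z - w)) ⊆ (fun w => z - w) ⁻¹' tsupport η :=
    closure_minimal (fun w hw => subset_tsupport η hw) hcl
  have hφc : HasCompactSupport fun w => η (z - w) :=
    hηc.comp_homeomorph (Homeomorph.subLeft z)
  have hder : ∀ w, fderiv ℝ (fun w => η (z - w)) w v = - fderiv ℝ η (z - w) v := by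
    intro w
    have := ((h1.differentiable one_ne_zero (z - w)).hasFDerivAt).comp w
      ((hasFDerivAt_const z w).sub (hasFDerivAt_id w))
    rw [show (fun w => η (z - w)) = η ∘ HSub.hSub z from rfl, this.fderiv]
    simp
  have hweak := hw _ hφ hφc (fun w hw' => hz w (hts hw')) v
  simp only [hder, neg_smul, integral_neg, neg_inj] at hweak
  have hint := (hηc.fderiv ℝ).convolutionExists_left
    ((ContinuousLinearMap.lsmul ℝ ℝ).precompL ℂ) (h1.continuous_fderiv one_ne_zero)
    hF.locallyIntegrable (μ := volume) z
  rw [← hweak, (hηc.hasFDerivAt_convolution_left _ h1 hF.locallyIntegrable z).fderiv,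
    convolution_def, ContinuousLinearMap.integral_apply hint, ← integral_sub_left_eq_self _ _ z]
  refine integral_congr_ae (Filter.Eventually.of_forall fun w => ?_)
  change fderiv ℝ η (z - w) v • F (z - (z - w)) = _
  rw [sub_sub_cancel]

/-- Mollification does not increase the `L²` norm of a weak derivative. -/
theorem lintegral_fderiv_convolution_sq_le {U V : Set ℂ} (hU : MeasurableSet U) {F : ℂ → ℂ}
    (hF : Continuous F)
    (hw : ∀ φ : ℂ → ℝ, ContDiff ℝ ∞ φ → HasCompactSupport φ → tsupport φ ⊆ U →
      ∀ v : ℂ, ∫ z, (fderiv ℝ φ z v) • F z = - ∫ z, φ z • fderiv ℝ F z v)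
    (η : ContDiffBump (0 : ℂ)) (hV : MeasurableSet V)
    (hz : ∀ z ∈ V, Metric.closedBall z η.rOut ⊆ U) :
    ∫⁻ z in V, ‖fderiv ℝ (convolution (η.normed volume) F
      (ContinuousLinearMap.lsmul ℝ ℝ) volume) z‖ₑ ^ 2 ≤ ∫⁻ z in U, ‖fderiv ℝ F z‖ₑ ^ 2 := by
  set k : ℂ → ENNReal := fun z => ‖η.normed volume z‖ₑ with hk
  have hkm : Measurable k := η.continuous_normed.enorm.measurable
  have hDm : Measurable fun w => ‖fderiv ℝ F w‖ₑ := (measurable_fderiv ℝ F).enorm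
  have hk1 : ∫⁻ z, k z = 1 := by
    have := ofReal_integral_eq_lintegral_ofReal (η.integrable_normed (μ := volume))
      (Filter.Eventually.of_forall η.nonneg_normed)
    rw [η.integral_normed, ENNReal.ofReal_one] at this
    rw [this]
    exact lintegral_congr fun z => Real.enorm_of_nonneg (η.nonneg_normed z)
  have hsub : ∀ z ∈ V, ∀ w, z - w ∈ tsupport (η.normed volume) → w ∈ U := by
    intro z hzV w hw'
    rw [η.tsupport_normed_eq, mem_closedBall_zero_iff] at hw'
    refine hz z hzV ?_
    rwa [mem_closedBall_iff_norm, norm_sub_rev]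
  have hpt : ∀ z ∈ V, ‖fderiv ℝ (convolution (η.normed volume) F
      (ContinuousLinearMap.lsmul ℝ ℝ) volume) z‖ₑ ≤
      ∫⁻ w in U, k (z - w) * ‖fderiv ℝ F w‖ₑ := by
    intro z hzV
    refine ContinuousLinearMap.opENorm_le_bound _ fun v => ?_
    rw [fderiv_convolution_eq_of_weak_derivative hF hw η.contDiff_normed
      η.hasCompactSupport_normed (hsub z hzV)]
    refine (enorm_integral_le_lintegral_enorm _).trans ?_
    rw [← lintegral_indicator hU, ← lintegral_mul_const _ (by fun_prop)]
    refine lintegral_mono fun w => ?_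
    by_cases hwU : w ∈ U
    · simp only [Set.indicator_of_mem hwU, enorm_smul, mul_assoc]
      exact mul_le_mul_right (ContinuousLinearMap.le_opENorm _ _) _
    · have : η.normed volume (z - w) = 0 := by
        by_contra hne
        exact hwU (hsub z hzV w (subset_tsupport _ hne))
      simp [this]
  have hkz : ∀ z, ∫⁻ w, k (z - w) = 1 := by
    intro z
    rw [lintegral_sub_left_eq_self, hk1]
  have hjensen : ∀ z ∈ V, ‖fderiv ℝ (convolution (η.normed volume) F
      (ContinuousLinearMap.lsmul ℝ ℝ) volume) z‖ₑ ^ 2 ≤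
      ∫⁻ w in U, k (z - w) * ‖fderiv ℝ F w‖ₑ ^ 2 := by
    intro z hzV
    have hkzm : Measurable fun w => k (z - w) := hkm.comp (measurable_const.sub measurable_id)
    -- Jensen's inequality, as Cauchy–Schwarz for the measure `k (z - w) dw` on `U`, of mass at most
    -- 1.
    have hcs := sq_lintegral_le ((volume.restrict U).withDensity fun w => k (z - w))
      hDm.aemeasurable
    rw [lintegral_withDensity_eq_lintegral_mul _ hkzm hDm,
      lintegral_withDensity_eq_lintegral_mul _ hkzm (hDm.pow_const 2),
      withDensity_apply _ MeasurableSet.univ, Measure.restrict_univ] at hcs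
    refine (pow_le_pow_left' (hpt z hzV) 2).trans (hcs.trans ?_)
    refine mul_le_of_le_one_left' ?_
    exact (setLIntegral_le_lintegral _ _).trans (hkz z).le
  calc _ ≤ ∫⁻ z in V, ∫⁻ w in U, k (z - w) * ‖fderiv ℝ F w‖ₑ ^ 2 :=
        setLIntegral_mono' hV hjensen
    _ ≤ ∫⁻ z, ∫⁻ w in U, k (z - w) * ‖fderiv ℝ F w‖ₑ ^ 2 := setLIntegral_le_lintegral _ _
    _ = ∫⁻ w in U, ∫⁻ z, k (z - w) * ‖fderiv ℝ F w‖ₑ ^ 2 := by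
        refine lintegral_lintegral_swap (Measurable.aemeasurable ?_)
        exact (hkm.comp (measurable_fst.sub measurable_snd)).mul
          ((hDm.pow_const 2).comp measurable_snd)
    _ = _ := by
        refine lintegral_congr fun w => ?_
        have hm : Measurable fun z => k (z - w) := hkm.comp (measurable_id.sub measurable_const)
        rw [lintegral_mul_const _ hm, lintegral_sub_right_eq_self, hk1, one_mul]

/-! ### Energy and oscillation of quasiconformal maps -/

/-- The area inequality bounding the energy of an injective map of bounded dilatation. -/
theorem lintegral_fderiv_sq_le_of_dilatation {K : ℝ} (hK0 : 0 ≤ K) {U : Set ℂ}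
    (hU : MeasurableSet U) {F : ℂ → ℂ} (hF : Set.InjOn F U)
    (hK : ∀ᵐ z ∂(volume.restrict U), ‖fderiv ℝ F z‖ ^ 2 ≤ K * (fderiv ℝ F z).det) :
    ∫⁻ z in U, ‖fderiv ℝ F z‖ₑ ^ 2 ≤ ENNReal.ofReal K * volume (F '' U) := by
  set S : Set ℂ := {z | DifferentiableAt ℝ F z}
  have hS : MeasurableSet S := measurableSet_of_differentiableAt ℝ F
  calc ∫⁻ z in U, ‖fderiv ℝ F z‖ₑ ^ 2
      ≤ ∫⁻ z in U, S.indicator (fun z => ‖fderiv ℝ F z‖ₑ ^ 2) z := by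
        refine lintegral_mono fun z => ?_
        -- Off `S` the derivative has the default value 0, so the change of variables is needed only
        -- on `S`.
        by_cases hz : z ∈ S
        · rw [Set.indicator_of_mem hz]
        · simp [fderiv_zero_of_not_differentiableAt (show ¬ DifferentiableAt ℝ F z from hz)]
    _ ≤ ∫⁻ z in U, S.indicator (fun z => ENNReal.ofReal K *
          ENNReal.ofReal |(fderiv ℝ F z).det|) z := by
        refine lintegral_mono_ae ?_
        filter_upwards [hK] with z hz
        refine Set.indicator_le_indicator ?_
        rw [← ofReal_norm, ← ENNReal.ofReal_pow (norm_nonneg _), ← ENNReal.ofReal_mul hK0]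
        exact ENNReal.ofReal_le_ofReal (hz.trans (mul_le_mul_of_nonneg_left (le_abs_self _) hK0))
    _ = ENNReal.ofReal K * ∫⁻ z in S ∩ U, ENNReal.ofReal |(fderiv ℝ F z).det| := by
        rw [lintegral_indicator hS, Measure.restrict_restrict hS,
          lintegral_const_mul' _ _ ENNReal.ofReal_ne_top]
    _ = ENNReal.ofReal K * volume (F '' (S ∩ U)) := by
        rw [lintegral_abs_det_fderiv_eq_addHaar_image volume (hS.inter hU)
          (fun z hz => hz.1.hasFDerivAt.hasFDerivWithinAt) (hF.mono Set.inter_subset_right)]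
    _ ≤ _ := by gcongr; exact Set.inter_subset_right

/-- The length-area estimate for quasiconformal maps of a disk. -/
theorem IsPlaneQuasiconformal.four_mul_norm_sub_sq_mul_log_le {K : ℝ} (hK : 0 ≤ K) {F : ℂ → ℂ}
    (hF : Continuous F) {c : ℂ} {r R : ℝ} (hr : 0 < r) (hrR : r < R)
    (hqc : IsPlaneQuasiconformal K (Metric.ball c R) F)
    (hvol : volume (F '' Metric.ball c R) ≤ 1) {x : ℂ} (hx : x ∈ Metric.ball c r) :
    4 * ‖F x - F c‖ ^ 2 * Real.log (R / r) ≤ 2 * Real.pi * K := by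
  have hinj : Set.InjOn F (Metric.ball c R) := by
    rw [Set.injOn_iff_injective]; exact hqc.isOpenEmbedding.injective
  have hopen : ∀ ρ ≤ R, IsOpen (F '' Metric.ball c ρ) := by
    intro ρ hρ
    have := hqc.isOpenEmbedding.isOpenMap _
      ((Metric.isOpen_ball (x := c) (ε := ρ)).preimage continuous_subtype_val)
    convert this using 1
    ext y
    constructor
    · rintro ⟨z, hz, rfl⟩
      exact ⟨⟨z, Metric.ball_subset_ball hρ hz⟩, hz, rfl⟩
    · rintro ⟨z, hz, rfl⟩
      exact ⟨z, hz, rfl⟩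
  have henergy : ∫⁻ z in Metric.ball c R, ‖fderiv ℝ F z‖ₑ ^ 2 ≤ ENNReal.ofReal K :=
    (lintegral_fderiv_sq_le_of_dilatation hK measurableSet_ball hinj hqc.dilatation).trans
      (mul_le_of_le_one_right' hvol)
  -- Mollifying with error `t` costs `2 * t` in the distance of two image points and `t` in the
  -- radius; the `max` keeps the bound nonnegative before squaring.
  have key : ∀ t ∈ Set.Ioo 0 (R - r),
      4 * (max (‖F x - F c‖ - 2 * t) 0) ^ 2 * Real.log ((R - t) / r) ≤ 2 * Real.pi * K := by
    intro t ht
    obtain ⟨δ, hδ, hδF⟩ := Metric.uniformContinuousOn_iff.1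
      ((isCompact_closedBall c R).uniformContinuousOn_of_continuous hF.continuousOn) t ht.1
    -- `δ` controls the error; `ε < t` keeps the kernel inside the disk of radius `R`.
    set ε := min δ (t / 2) with hε
    have hε0 : 0 < ε := lt_min hδ (half_pos ht.1)
    have hεt : ε < t := (min_le_right _ _).trans_lt (half_lt_self ht.1)
    let η : ContDiffBump (0 : ℂ) := ⟨ε / 2, ε, half_pos hε0, half_lt_self hε0⟩
    set h := convolution (η.normed volume) F (ContinuousLinearMap.lsmul ℝ ℝ) volume with hh
    have hC1 : ContDiff ℝ 1 h :=
      η.hasCompactSupport_normed.contDiff_convolution_left _ η.contDiff_normed hF.locallyIntegrable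
    have happrox : ∀ p ∈ Metric.ball c (R - t), dist (h p) (F p) ≤ t := by
      intro p hp
      refine η.dist_normed_convolution_le hF.aestronglyMeasurable fun y hy => ?_
      have hy' : dist y p < ε := hy
      rw [Metric.mem_ball] at hp
      refine (hδF y ?_ p ?_ (hy'.trans_le (min_le_left _ _))).le
      · rw [Metric.mem_closedBall]
        linarith [dist_triangle y p c]
      · rw [Metric.mem_closedBall]
        linarith [ht.1]
    have hE := lintegral_fderiv_convolution_sq_le measurableSet_ball hF hqc.weak_derivative η
      (V := Metric.ball c (R - t)) measurableSet_ball fun z hz =>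
        Metric.closedBall_subset_ball' (by
          have : dist z c < R - t := hz
          change ε + dist z c < R
          linarith)
    have hLA := length_area_inequality hC1 c hr (R := R - t) (by linarith [ht.2])
      (le_max_right (‖F x - F c‖ - 2 * t) 0) (by
        intro ρ hρ
        have hbρ : IsOpen (F '' Metric.ball c ρ) := hopen ρ (by linarith [hρ.2, ht.1])
        have hxρ : x ∈ Metric.closedBall c ρ :=
          Metric.ball_subset_closedBall (Metric.ball_subset_ball hρ.1.le hx)
        obtain ⟨p, hp, hp'⟩ := exists_sphere_norm_sub_le hF hbρ hxρ (F c)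
        -- The same maximum principle, now for the distance to `F p` and starting from the centre:
        -- `‖F q - F p‖ ≥ ‖F c - F p‖`.
        obtain ⟨q, hq, hq'⟩ := exists_sphere_norm_sub_le hF hbρ
          (Metric.mem_closedBall_self (hr.trans hρ.1).le) (F p)
        refine ⟨p, hp, q, hq, max_le ?_ (norm_nonneg _)⟩
        have hsph : ∀ y ∈ Metric.sphere c ρ, dist (h y) (F y) ≤ t := fun y hy =>
          happrox y (Metric.sphere_subset_ball hρ.2 hy)
        have h1 := dist_triangle4 (F p) (h p) (h q) (F q)
        have hpt := hsph p hp
        have hqt := hsph q hq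
        rw [dist_comm] at hpt
        rw [norm_sub_rev, norm_sub_rev (F q)] at hq'
        simp only [← dist_eq_norm] at hq' hp' ⊢
        linarith)
    have := hLA.trans (mul_le_mul_right (hE.trans henergy) _)
    rw [← ENNReal.ofReal_mul (by positivity)] at this
    exact (ENNReal.ofReal_le_ofReal_iff (by positivity)).1 this
  have hlim : Filter.Tendsto
      (fun t : ℝ => 4 * (max (‖F x - F c‖ - 2 * t) 0) ^ 2 * Real.log ((R - t) / r))
      (nhdsWithin 0 (Set.Ioi 0)) (nhds (4 * ‖F x - F c‖ ^ 2 * Real.log (R / r))) := by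
    have hc : ContinuousAt
        (fun t : ℝ => 4 * (max (‖F x - F c‖ - 2 * t) 0) ^ 2 * Real.log ((R - t) / r)) 0 := by
      refine ContinuousAt.mul (by fun_prop) (ContinuousAt.log (by fun_prop) ?_)
      have : 0 < R := hr.trans hrR
      rw [sub_zero]; positivity
    have := hc.tendsto.mono_left (nhdsWithin_le_nhds (s := Set.Ioi 0))
    simpa using this
  refine le_of_tendsto hlim ?_
  filter_upwards [Ioo_mem_nhdsGT (sub_pos.2 hrR)] with t ht using key t ht

/-! ### Coverings, area and injectivity radius of flat tori -/

namespace FlatTorus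

theorem proj_eq_proj_iff {Λ : Submodule ℤ ℂ} {z w : ℂ} :
    proj Λ z = proj Λ w ↔ z - w ∈ Λ := Submodule.Quotient.eq Λ

theorem proj_surjective (Λ : Submodule ℤ ℂ) : Function.Surjective (proj Λ) :=
  Submodule.Quotient.mk_surjective Λ

theorem dist_proj_le (Λ : Submodule ℤ ℂ) (z w : ℂ) : dist (proj Λ z) (proj Λ w) ≤ dist z w := by
  rw [dist_eq_norm, dist_eq_norm]
  exact Submodule.Quotient.norm_mk_le (S := Λ) (z - w)

theorem continuous_proj (Λ : Submodule ℤ ℂ) : Continuous (proj Λ) :=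
  (LipschitzWith.of_dist_le_mul (K := 1) fun z w => by simpa using dist_proj_le Λ z w).continuous

theorem isCoveringMap_proj (Λ : Submodule ℤ ℂ) [DiscreteTopology Λ] :
    IsCoveringMap (proj Λ) :=
  (AddSubgroup.isAddQuotientCoveringMap_of_comm Λ.toAddSubgroup
    (isDiscrete_iff_discreteTopology.2 ‹_›)).isCoveringMap

theorem exists_lift {Λ₁ Λ₂ : Submodule ℤ ℂ} [DiscreteTopology Λ₂]
    {f : FlatTorus Λ₁ → FlatTorus Λ₂} (hf : Continuous f) :
    ∃ F : ℂ → ℂ, Continuous F ∧ ∀ z, proj Λ₂ (F z) = f (proj Λ₁ z) := by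
  obtain ⟨e, he⟩ := proj_surjective Λ₂ (f (proj Λ₁ 0))
  obtain ⟨F, ⟨-, hF⟩, -⟩ := (isCoveringMap_proj Λ₂).existsUnique_continuousMap_lifts
    ⟨fun z => f (proj Λ₁ z), hf.comp (continuous_proj Λ₁)⟩ 0 e he
  exact ⟨F, F.continuous, fun z => congrFun hF z⟩

theorem exists_proj_eq_of_dist_lt {Λ : Submodule ℤ ℂ} {z : ℂ} {y : FlatTorus Λ} {r : ℝ}
    (h : dist y (proj Λ z) < r) : ∃ w ∈ Metric.ball z r, proj Λ w = y := by
  rw [dist_eq_norm] at h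
  obtain ⟨m, hm, hmr⟩ := Submodule.Quotient.norm_mk_lt (y - proj Λ z) (sub_pos.2 h)
  refine ⟨z + m, ?_, ?_⟩
  · rw [mem_ball_iff_norm]
    simpa using hmr
  · change proj Λ z + proj Λ m = y
    rw [show proj Λ m = y - proj Λ z from hm, add_sub_cancel]

/-- A set embedded by the covering map has at most the area of the torus. -/
theorem volume_le_area {Λ : Submodule ℤ ℂ} [DiscreteTopology Λ] [IsZLattice ℝ Λ] {S : Set ℂ}
    (hS : NullMeasurableSet S) (hinj : Set.InjOn (proj Λ) S) :
    volume S ≤ ENNReal.ofReal (area Λ) := by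
  have : MeasurableVAdd Λ ℂ := (inferInstance : MeasurableVAdd Λ.toAddSubgroup ℂ)
  have : VAddInvariantMeasure Λ ℂ (volume : Measure ℂ) :=
    (inferInstance : VAddInvariantMeasure Λ.toAddSubgroup ℂ volume)
  set b := Module.Free.chooseBasis ℤ Λ
  have hfund := ZLattice.isAddFundamentalDomain b (volume : Measure ℂ)
  have hfin : volume (ZSpan.fundamentalDomain (b.ofZLatticeBasis ℝ)) ≠ ⊤ :=
    (Bornology.IsBounded.measure_lt_top (ZSpan.fundamentalDomain_isBounded _)).ne
  rw [area, ZLattice.covolume_eq_measure_fundamentalDomain Λ volume hfund, ofReal_measureReal hfin]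
  by_contra hlt
  -- Blichfeldt's principle: a set larger than a fundamental domain meets one of its translates.
  obtain ⟨l, m, hlm, hd⟩ := exists_pair_mem_lattice_not_disjoint_vadd hfund hS (not_le.1 hlt)
  obtain ⟨_, ⟨z, hz, rfl⟩, w, hw, hzw⟩ := Set.not_disjoint_iff.1 hd
  have hzw' : (m : ℂ) + w = l + z := hzw
  have hproj : proj Λ z = proj Λ w := by
    rw [proj_eq_proj_iff, show z - w = ((m - l : Λ) : ℂ) by push_cast; linear_combination -hzw']
    exact (m - l).2
  rw [hinj hz hw hproj] at hzw'
  exact hlm (Subtype.ext (add_right_cancel hzw').symm)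

theorem expMap_injOn_iff {Λ : Submodule ℤ ℂ} {p : FlatTorus Λ} {S : Set ℂ} :
    Set.InjOn (expMap Λ p) S ↔ Set.InjOn (proj Λ) S := by
  simp only [Set.InjOn, expMap, add_right_inj]

/-- A nonzero lattice vector is identified with 0, which bounds the radii. Without a bound the real
`sSup` would be the default value 0. -/
theorem bddAbove_injRadius (Λ : Submodule ℤ ℂ) [DiscreteTopology Λ] [IsZLattice ℝ Λ] :
    BddAbove {s : ℝ | ∀ p : FlatTorus Λ, Set.InjOn (expMap Λ p) (Metric.ball 0 s)} := by
  obtain ⟨l, hl, hl0⟩ : ∃ l ∈ Λ, l ≠ 0 := by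
    by_contra! h
    have hspan := IsZLattice.span_top (K := ℝ) (L := Λ)
    rw [Submodule.span_eq_bot.2 h] at hspan
    exact bot_ne_top hspan
  refine ⟨‖l‖, fun s hs => ?_⟩
  by_contra! hlt
  refine hl0 (expMap_injOn_iff.1 (hs 0) (show l ∈ Metric.ball 0 s by simpa using hlt)
    (Metric.mem_ball_self ((norm_nonneg l).trans_lt hlt)) ?_)
  rw [proj_eq_proj_iff, sub_zero]
  exact hl

theorem injRadius_pos (Λ : Submodule ℤ ℂ) [DiscreteTopology Λ] [IsZLattice ℝ Λ] :
    0 < injRadius Λ := by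
  obtain ⟨ε, hε, hε'⟩ := Metric.mem_nhds_iff.1 (show {l : Λ | l = 0} ∈ nhds (0 : Λ) from
    (isOpen_discrete _).mem_nhds rfl)
  refine (half_pos hε).trans_le (le_csSup (bddAbove_injRadius Λ) fun p => ?_)
  rw [expMap_injOn_iff]
  intro z hz w hw hzw
  rw [proj_eq_proj_iff] at hzw
  rw [mem_ball_zero_iff] at hz hw
  have : (⟨z - w, hzw⟩ : Λ) ∈ Metric.ball (0 : Λ) ε := by
    rw [mem_ball_zero_iff]
    change ‖z - w‖ < ε
    linarith [norm_sub_le z w]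
  exact sub_eq_zero.1 (congrArg Subtype.val (hε' this))

/-- Two points of the open disk already lie in a concentric disk of some admissible radius. -/
theorem injOn_proj_ball_injRadius (Λ : Submodule ℤ ℂ) (z : ℂ) :
    Set.InjOn (proj Λ) (Metric.ball z (injRadius Λ)) := by
  intro u hu w hw huw
  rw [mem_ball_iff_norm] at hu hw
  set S := {s : ℝ | ∀ p : FlatTorus Λ, Set.InjOn (expMap Λ p) (Metric.ball 0 s)}
  have hne : S.Nonempty := ⟨0, fun p => by simp⟩
  obtain ⟨s, hs, hlt⟩ := exists_lt_of_lt_csSup hne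
    (show max ‖u - z‖ ‖w - z‖ < sSup S from max_lt hu hw)
  have := expMap_injOn_iff.1 (hs 0) (show u - z ∈ Metric.ball 0 s by
    simpa using (le_max_left _ _).trans_lt hlt) (show w - z ∈ Metric.ball 0 s by
    simpa using (le_max_right _ _).trans_lt hlt) (by
      rw [proj_eq_proj_iff] at huw ⊢
      simpa using huw)
  exact sub_left_injective this

end FlatTorus

/-! ### The modulus of continuity -/

open FlatTorus

theorem IsTorusQuasiconformal.dist_le {Λ₁ Λ₂ : Submodule ℤ ℂ}
    [DiscreteTopology Λ₂] [IsZLattice ℝ Λ₂] (hΛ₂ : area Λ₂ = 1) {K : ℝ} (hK : 0 ≤ K)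
    {f : FlatTorus Λ₁ ≃ₜ FlatTorus Λ₂} (hf : IsTorusQuasiconformal K f) {r : ℝ} (hr : 0 < r)
    (hrJ : r < injRadius Λ₁) {x y : FlatTorus Λ₁} (hxy : dist x y < r) :
    dist (f x) (f y) ≤ Real.sqrt (Real.pi * K / (2 * Real.log (injRadius Λ₁ / r))) := by
  set J := injRadius Λ₁ with hJ
  obtain ⟨c, rfl⟩ := proj_surjective Λ₁ y
  obtain ⟨w, hw, rfl⟩ := exists_proj_eq_of_dist_lt hxy
  obtain ⟨F, hF, hlift⟩ := exists_lift f.continuous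
  have hinj := injOn_proj_ball_injRadius Λ₁ c
  have hqc := hf (Metric.ball c J) F Metric.isOpen_ball hinj hF.continuousOn fun z _ => hlift z
  have hopen : IsOpen (F '' Metric.ball c J) := by
    have := hqc.isOpenEmbedding.isOpen_range
    rwa [Set.range_domRestrict] at this
  have hvol : volume (F '' Metric.ball c J) ≤ 1 := by
    refine (volume_le_area (Λ := Λ₂) hopen.measurableSet.nullMeasurableSet ?_).trans_eq
      (by rw [hΛ₂, ENNReal.ofReal_one])
    -- On the image of `F` the covering is injective because `f` and the covering of the source disk
    -- are.
    rintro _ ⟨u, hu, rfl⟩ _ ⟨v, hv, rfl⟩ huv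
    rw [hlift, hlift] at huv
    rw [hinj hu hv (f.injective huv)]
  have hest := hqc.four_mul_norm_sub_sq_mul_log_le hK hF hr hrJ hvol hw
  have hlog : 0 < Real.log (J / r) := Real.log_pos ((one_lt_div hr).2 hrJ)
  rw [← hlift, ← hlift]
  refine (dist_proj_le Λ₂ _ _).trans (Real.le_sqrt_of_sq_le ?_)
  rw [dist_eq_norm, le_div_iff₀ (by positivity)]
  linarith

theorem mainTheorem4
    (Λ₁ Λ₂ : Submodule ℤ ℂ) [DiscreteTopology Λ₁] [IsZLattice ℝ Λ₁]
    [DiscreteTopology Λ₂] [IsZLattice ℝ Λ₂]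
    (hΛ₁ : FlatTorus.area Λ₁ = 1) (hΛ₂ : FlatTorus.area Λ₂ = 1)
    (K : ℝ) (hK : 0 < K)
    {ι : Type*} (f : ι → (FlatTorus Λ₁ ≃ₜ FlatTorus Λ₂))
    (hf : ∀ i, IsTorusQuasiconformal K (f i)) :
    UniformEquicontinuous (fun i => (f i : FlatTorus Λ₁ → FlatTorus Λ₂)) ∧
    ∀ (i : ι) (r : ℝ), 0 < r → r < FlatTorus.injRadius Λ₁ →
      ∀ x y : FlatTorus Λ₁, dist x y < r →
        dist (f i x) (f i y) ≤
          Real.sqrt (Real.pi * K / (2 * Real.log (FlatTorus.injRadius Λ₁ / r))) := by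
  have hbound : ∀ (i : ι) (r : ℝ), 0 < r → r < FlatTorus.injRadius Λ₁ →
      ∀ x y : FlatTorus Λ₁, dist x y < r →
        dist (f i x) (f i y) ≤
          Real.sqrt (Real.pi * K / (2 * Real.log (FlatTorus.injRadius Λ₁ / r))) :=
    fun i r hr hrJ x y hxy => (hf i).dist_le hΛ₂ hK.le hr hrJ hxy
  refine ⟨?_, hbound⟩
  have hJ := injRadius_pos Λ₁
  -- The bound tends to 0 with `r`, so a small `r` itself serves as the `δ` of equicontinuity.
  have hlim : Filter.Tendsto (fun r : ℝ =>
      Real.sqrt (Real.pi * K / (2 * Real.log (FlatTorus.injRadius Λ₁ / r))))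
      (nhdsWithin 0 (Set.Ioi 0)) (nhds 0) := by
    have hdiv : Filter.Tendsto (fun r : ℝ => injRadius Λ₁ / r) (nhdsWithin 0 (Set.Ioi 0))
        Filter.atTop := by
      simpa only [div_eq_mul_inv] using tendsto_inv_nhdsGT_zero.const_mul_atTop hJ
    have hzero := ((Real.tendsto_log_atTop.comp hdiv).const_mul_atTop
      two_pos).const_div_atTop (Real.pi * K)
    have hsqrt := (Real.continuous_sqrt.tendsto 0).comp hzero
    rwa [Real.sqrt_zero] at hsqrt
  rw [Metric.uniformEquicontinuous_iff]
  intro ε hε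
  obtain ⟨r, hrε, hr, hrJ⟩ := ((hlim.eventually (gt_mem_nhds hε)).and
    (Ioo_mem_nhdsGT hJ)).exists
  exact ⟨r, hr, fun x y hxy i => (hbound i r hr hrJ x y hxy).trans_lt hrε⟩
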